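/- Let $n\ge 2$ be an integer, let $a$ be an integer such that the polynomial $x^n-a$ is irreducible over $\mathbb{Z}$, and let $K=\mathbb{Q}(\theta)$, where $\theta$ is a root of $x^n-a$. Then $\{1,\theta,\dots,\theta^{n-1}\}$ is an integral basis of $K$ (that is, a $\mathbb{Z}$-basis of the ring of algebraic integers of $K$) if and only if $a$ is squarefree and, for every prime $p$ dividing $n$, $p^2\nmid a^{p-1}-1$. (Here $\pm 1$ count as squarefree.) -/

import Mathlib

open Polynomial NumberField

/-! With `f = X^n - a`, the ring `ℤ[θ]` is maximal iff it is `p`-maximal at every prime `p`, and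
Dedekind's criterion decides the latter: write `f = g^q + p (g u + c)` with `g` squarefree mod `p`;
then `p ∤ c` suffices. If `p ∣ a`, take `g = X` and `c = -a/p`, prime to `p` as `a` is squarefree.
If `p ∤ a n`, `f` itself is squarefree mod `p`. If `p ∤ a` and `n = p^k m` with `k ≥ 1`, `p ∤ m`,
take `g = X^m - a`, `q = p^k`, `c = (a^(p^k) - a)/p`; here `p ∣ c` would give `p² ∣ a^(p-1) - 1`.
Conversely, a failing condition yields an integer outside `ℤ[θ]`: `θ^(n-1)/d` if `d² ∣ a` with `d`
not a unit, or `(1/p) ∑ θ^(m i) a^(p-1-i)` if `n = p m` and `p² ∣ a^(p-1) - 1`. -/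

/-- If `γ v = y` with `v` integral over `ℤ`, `γ = h(θ)` and `y = t(θ)`, then a power of `y` lies
in `γ ℤ[θ]`. -/
theorem exists_pow_eq_mul_of_isIntegral {K : Type*} [Field K] {θ v : K} (hv : IsIntegral ℤ v)
    {h t : ℤ[X]} (hvt : aeval θ h * v = aeval θ t) :
    ∃ (N : ℕ) (S : ℤ[X]), aeval θ (t ^ N) = aeval θ (h * S) := by
  obtain ⟨P, hP, hPv⟩ := hv
  rw [← aeval_def, hP.as_sum] at hPv
  refine ⟨P.natDegree,
    -∑ j ∈ Finset.range P.natDegree, C (P.coeff j) * h ^ (P.natDegree - j - 1) * t ^ j, ?_⟩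
  -- Scaling by `h(θ) ^ deg P` homogenises the equation, so each `h(θ) v` becomes `t(θ)`.
  have key := congrArg (fun x => aeval θ h ^ P.natDegree * x) hPv
  simp only [map_add, map_pow, aeval_X, map_sum, map_mul, aeval_C, mul_zero, mul_add,
    Finset.mul_sum, ← mul_pow, hvt] at key
  simp only [map_pow, map_mul, map_neg, map_sum, aeval_C, mul_neg, Finset.mul_sum]
  rw [eq_neg_iff_add_eq_zero, ← key]
  congr 1
  refine Finset.sum_congr rfl fun j hj => ?_
  have hj := Finset.mem_range.1 hj
  obtain ⟨d, hd⟩ : ∃ d, P.natDegree = j + (d + 1) := ⟨P.natDegree - j - 1, by omega⟩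
  rw [← hvt, hd, show j + (d + 1) - j - 1 = d by omega]
  ring

/-- Divisibility modulo `p`, lifted to `ℤ[X]`. -/
theorem exists_eq_mul_add_mul_of_map_dvd {p : ℕ} {g T : ℤ[X]}
    (h : g.map (Int.castRingHom (ZMod p)) ∣ T.map (Int.castRingHom (ZMod p))) :
    ∃ S W : ℤ[X], T = g * S + C (p : ℤ) * W := by
  obtain ⟨s, hs⟩ := h
  obtain ⟨S, rfl⟩ := Polynomial.map_surjective (Int.castRingHom (ZMod p))
    (ZMod.ringHom_surjective _) s
  have h0 : (T - g * S).map (Int.castRingHom (ZMod p)) = 0 := by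
    rw [Polynomial.map_sub, Polynomial.map_mul, hs, sub_self]
  obtain ⟨W, hW⟩ : C (p : ℤ) ∣ T - g * S := by
    rw [C_dvd_iff_dvd_coeff]
    intro i
    rw [← ZMod.intCast_zmod_eq_zero_iff_dvd, ← eq_intCast (Int.castRingHom (ZMod p)), ← coeff_map,
      h0, coeff_zero]
  exact ⟨S, W, by linear_combination hW⟩

/-! ### Dedekind's criterion at one prime -/

section Maximality

variable {K : Type*} [Field K] [CharZero K] {θ : K} {f g u : ℤ[X]} {p q : ℕ} {c : ℤ}

/-- The inductive step of Dedekind's criterion: filter `ℤ[θ] / p` by powers of `g(θ)`. -/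
theorem exists_eq_mul_add_mul_of_isIntegral [Fact p.Prime]
    (hker : ∀ P : ℤ[X], aeval θ P = 0 → f ∣ P) (hf : aeval θ f = 0)
    (hfg : f = g ^ q + C (p : ℤ) * (g * u + C c))
    (hg : Squarefree (g.map (Int.castRingHom (ZMod p)))) (hc : ¬ (p : ℤ) ∣ c)
    {z : K} (hz : IsIntegral ℤ z) (hθ : IsIntegral ℤ θ) {i : ℕ} (hi : i < q) {T : ℤ[X]}
    (hzT : (p : K) * z = aeval θ (g ^ i * T)) :
    ∃ S W : ℤ[X], T = g * S + C (p : ℤ) * W := by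
  have hp0 : (p : K) ≠ 0 := Nat.cast_ne_zero.2 (Fact.out : p.Prime).ne_zero
  have hint (P : ℤ[X]) : IsIntegral ℤ (aeval θ P) :=
    adjoin_le_integralClosure hθ (aeval_mem_adjoin_singleton _ _)
  obtain ⟨d, rfl⟩ : ∃ d, q = i + d + 1 := ⟨q - i - 1, by omega⟩
  -- Multiply `p z = g^i T` by `g^(d+1)` and replace `g^q` by `-p (g u + c)`: this integral `v`
  -- satisfies `g v = -c T` at `θ`. Hence `g` divides a power of `c T` modulo `p`, and so `T`, as
  -- `g` is squarefree there.
  have hv : IsIntegral ℤ (aeval θ (g ^ d) * z + aeval θ (u * T)) :=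
    ((hint _).mul hz).add (hint _)
  obtain ⟨N, S, hNS⟩ := exists_pow_eq_mul_of_isIntegral (h := g) (t := -(C c * T)) hv (by
    apply mul_left_cancel₀ hp0
    have h1 : aeval θ (g ^ (i + d + 1) + C (p : ℤ) * (g * u + C c)) = 0 := hfg ▸ hf
    simp only [map_add, map_mul, map_pow, map_neg, aeval_C, map_natCast] at hzT h1 ⊢
    linear_combination aeval θ g ^ (d + 1) * hzT + aeval θ T * h1)
  obtain ⟨Q, hQ⟩ := hker ((-(C c * T)) ^ N - g * S) (by rw [map_sub, hNS, sub_self])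
  have hQ' := congrArg (Polynomial.map (Int.castRingHom (ZMod p))) hQ
  rw [hfg] at hQ'
  simp only [Polynomial.map_sub, Polynomial.map_mul, Polynomial.map_add, Polynomial.map_pow,
    Polynomial.map_neg, Polynomial.map_C, map_natCast, Polynomial.map_natCast,
    CharP.cast_eq_zero, zero_mul, add_zero, Int.coe_castRingHom] at hQ'
  apply exists_eq_mul_add_mul_of_map_dvd
  have hdvd : g.map (Int.castRingHom (ZMod p)) ∣
      (-(C (c : ZMod p) * T.map (Int.castRingHom (ZMod p)))) ^ N :=
    ⟨S.map (Int.castRingHom (ZMod p)) + g.map (Int.castRingHom (ZMod p)) ^ (i + d) *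
      Q.map (Int.castRingHom (ZMod p)), by linear_combination hQ'⟩
  have h2 := (dvd_neg.1 (hg.isRadical _ _ hdvd))
  have hcu : IsUnit (C (c : ZMod p)) := by
    rw [isUnit_C, isUnit_iff_ne_zero, Ne, ZMod.intCast_zmod_eq_zero_iff_dvd]
    exact hc
  exact hcu.dvd_mul_left.1 h2

/-- A form of Dedekind's criterion: `ℤ[θ]` is `p`-maximal. -/
theorem exists_aeval_eq_of_prime_mul [Fact p.Prime]
    (hker : ∀ P : ℤ[X], aeval θ P = 0 → f ∣ P) (hf : aeval θ f = 0)
    (hfg : f = g ^ q + C (p : ℤ) * (g * u + C c))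
    (hg : Squarefree (g.map (Int.castRingHom (ZMod p)))) (hc : ¬ (p : ℤ) ∣ c)
    {z : K} (hz : IsIntegral ℤ z) (hθ : IsIntegral ℤ θ) {T : ℤ[X]}
    (hzT : (p : K) * z = aeval θ T) : ∃ P : ℤ[X], aeval θ P = z := by
  have hp0 : (p : K) ≠ 0 := Nat.cast_ne_zero.2 (Fact.out : p.Prime).ne_zero
  have hint (P : ℤ[X]) : IsIntegral ℤ (aeval θ P) :=
    adjoin_le_integralClosure hθ (aeval_mem_adjoin_singleton _ _)
  have key : ∀ i ≤ q, ∃ S T' : ℤ[X], T = C (p : ℤ) * S + g ^ i * T' := by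
    intro i
    induction i with
    | zero => exact fun _ => ⟨0, T, by simp⟩
    | succ i ih =>
      intro hi
      obtain ⟨S, T', h⟩ := ih (by omega)
      obtain ⟨S', W, h'⟩ := exists_eq_mul_add_mul_of_isIntegral hker hf hfg hg hc
        (hz.sub (hint S)) hθ (i := i) (T := T') (by omega) (by
          rw [mul_sub, hzT, h]
          simp)
      exact ⟨S + g ^ i * W, S', by rw [h, h']; ring⟩
  obtain ⟨S, T', h⟩ := key q le_rfl
  -- At `i = q` the relation `g^q = -p (g u + c)` at `θ` makes all of `T(θ)` divisible by `p`.
  refine ⟨S - (g * u + C c) * T', mul_left_cancel₀ hp0 ?_⟩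
  rw [hzT, h]
  have h1 : aeval θ (g ^ q + C (p : ℤ) * (g * u + C c)) = 0 := hfg ▸ hf
  simp only [map_add, map_sub, map_mul, map_pow, aeval_C, map_natCast] at h1 ⊢
  linear_combination -aeval θ T' * h1

end Maximality

/-! ### The criterion applied to `X^n - a` -/

/-- If `p² ∣ a ^ p ^ k - a` with `k ≥ 1` and `p ∤ a`, then `p² ∣ a ^ (p - 1) - 1`. -/
theorem sq_dvd_pow_sub_one_of_sq_dvd {p : ℕ} [Fact p.Prime] {a : ℤ} (ha : ¬ (p : ℤ) ∣ a) (k : ℕ)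
    (h : (p : ℤ) ^ 2 ∣ a ^ p ^ (k + 1) - a) : (p : ℤ) ^ 2 ∣ a ^ (p - 1) - 1 := by
  have hp : p.Prime := Fact.out
  have hfermat (j : ℕ) : (p : ℤ) ∣ a ^ p ^ j - a := by
    rw [← ZMod.intCast_zmod_eq_zero_iff_dvd]
    push_cast
    rw [ZMod.pow_card_pow, sub_self]
  -- Raising a congruence mod `p` to the `p`-th power gives one mod `p²`.
  have h1 : (p : ℤ) ^ 2 ∣ a ^ p ^ (k + 1) - a ^ p := by
    have := dvd_sub_pow_of_dvd_sub (hfermat k) 1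
    rwa [pow_one, ← pow_mul, ← pow_succ] at this
  have h2 : (p : ℤ) ^ 2 ∣ a * (a ^ (p - 1) - 1) := by
    have := dvd_sub h h1
    rwa [show a ^ p ^ (k + 1) - a - (a ^ p ^ (k + 1) - a ^ p) = a * (a ^ (p - 1) - 1) by
      rw [mul_sub, mul_pow_sub_one hp.ne_zero]; ring] at this
  refine IsCoprime.dvd_of_dvd_mul_left (IsCoprime.pow_left ?_) h2
  exact ((Nat.prime_iff_prime_int.1 hp).coprime_iff_not_dvd).2 ha

/-- `(g + a) ^ p ^ k` is `g ^ p ^ k + a ^ p ^ k` up to a multiple of `p g`. -/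
theorem exists_add_C_pow_eq (p : ℕ) [Fact p.Prime] (k : ℕ) (g : ℤ[X]) (a : ℤ) :
    ∃ u : ℤ[X], (g + C a) ^ p ^ k = g ^ p ^ k + C (p : ℤ) * (g * u) + C a ^ p ^ k := by
  obtain ⟨r, hr⟩ := exists_add_pow_prime_pow_eq (Fact.out : p.Prime) g (C a) k
  exact ⟨C a * r, by rw [hr]; simp; ring⟩

/-- `ℤ[θ]` is `p`-maximal for every prime `p` under the conditions on `a`. -/
theorem exists_aeval_eq_of_prime_mul_of_pow {K : Type*} [Field K] [CharZero K] {n : ℕ}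
    (hn : n ≠ 0) {a : ℤ} {θ : K} (hθ : IsIntegral ℤ θ)
    (hker : ∀ P : ℤ[X], aeval θ P = 0 → X ^ n - C a ∣ P)
    (hf : aeval θ (X ^ n - C a : ℤ[X]) = 0) (hsq : Squarefree a)
    (hw : ∀ p : ℕ, p.Prime → p ∣ n → ¬ ((p : ℤ) ^ 2 ∣ a ^ (p - 1) - 1))
    {p : ℕ} (hp : p.Prime) {z : K} (hz : IsIntegral ℤ z) {T : ℤ[X]}
    (hzT : (p : K) * z = aeval θ T) : ∃ P : ℤ[X], aeval θ P = z := by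
  have : Fact p.Prime := ⟨hp⟩
  have hsep {m : ℕ} (hm : ¬ p ∣ m) (hpa : ¬ (p : ℤ) ∣ a) :
      Squarefree ((X ^ m - C a : ℤ[X]).map (Int.castRingHom (ZMod p))) := by
    have hm' : (m : ZMod p) ≠ 0 := by rwa [Ne, ZMod.natCast_eq_zero_iff]
    have ha' : (a : ZMod p) ≠ 0 := by rwa [Ne, ZMod.intCast_zmod_eq_zero_iff_dvd]
    simpa using (separable_X_pow_sub_C (a : ZMod p) hm' ha').squarefree
  by_cases hpa : (p : ℤ) ∣ a
  · obtain ⟨b, rfl⟩ := hpa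
    refine exists_aeval_eq_of_prime_mul (g := X) (q := n) (u := 0) (c := -b) hker hf (by simp; ring)
      (by simpa using (irreducible_X (R := ZMod p)).squarefree) ?_ hz hθ hzT
    rw [dvd_neg]
    rintro ⟨d, rfl⟩
    exact (Nat.prime_iff_prime_int.1 hp).not_isUnit (hsq _ ⟨d, by ring⟩)
  · obtain ⟨k, m, hm, rfl⟩ := Nat.exists_eq_pow_mul_and_not_dvd hn p hp.ne_one
    rcases k with _ | k
    -- Shifting by `p` leaves `g` unchanged mod `p` and makes `c = 1`.
    · refine exists_aeval_eq_of_prime_mul (g := X ^ m - C a - C (p : ℤ)) (q := 1) (u := 0) (c := 1)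
        hker hf (by simp) ?_ ?_ hz hθ hzT
      · have := hsep hm hpa
        simpa using this
      · exact fun h => (Nat.prime_iff_prime_int.1 hp).not_isUnit (isUnit_of_dvd_one h)
    · have hfermat : (p : ℤ) ∣ a ^ p ^ (k + 1) - a := by
        rw [← ZMod.intCast_zmod_eq_zero_iff_dvd]
        push_cast
        rw [ZMod.pow_card_pow, sub_self]
      obtain ⟨c, hc⟩ := hfermat
      obtain ⟨u, hu⟩ := exists_add_C_pow_eq p (k + 1) (X ^ m - C a) a
      refine exists_aeval_eq_of_prime_mul (g := X ^ m - C a) (q := p ^ (k + 1)) (u := u) (c := c)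
        hker hf ?_ (hsep hm hpa) ?_ hz hθ hzT
      · rw [sub_add_cancel, ← pow_mul, mul_comm m] at hu
        have hc' := congrArg (C : ℤ → ℤ[X]) hc
        rw [C_sub, C_mul, C_pow] at hc'
        linear_combination hu + hc'
      · rintro ⟨d, rfl⟩
        exact hw p hp (dvd_mul_of_dvd_left (dvd_pow_self _ k.succ_ne_zero) _)
          (sq_dvd_pow_sub_one_of_sq_dvd hpa k ⟨d, by rw [hc]; ring⟩)

/-! ### From `p`-maximality to maximality -/

/-- `p`-maximality at every prime gives maximality. -/
theorem exists_aeval_eq_of_forall_prime {K : Type*} [Field K] {θ : K}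
    (h : ∀ p : ℕ, p.Prime → ∀ z : K, IsIntegral ℤ z → ∀ T : ℤ[X], (p : K) * z = aeval θ T →
      ∃ P : ℤ[X], aeval θ P = z) (D : ℕ) (hD : D ≠ 0) :
    ∀ z : K, IsIntegral ℤ z → ∀ T : ℤ[X], (D : K) * z = aeval θ T →
      ∃ P : ℤ[X], aeval θ P = z := by
  induction D using Nat.recOnMul with
  | zero => exact absurd rfl hD
  | one => exact fun z _ T hT => ⟨T, by simpa using hT.symm⟩
  | prime p hp => exact h p hp
  | mul x y hx hy =>
    intro z hz T hT
    obtain ⟨P, hP⟩ := hx (left_ne_zero_of_mul hD) (y * z)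
      ((map_natCast (algebraMap ℤ K) y ▸ isIntegral_algebraMap).mul hz) T
      (by rw [← hT]; push_cast; ring)
    exact hy (right_ne_zero_of_mul hD) z hz P hP.symm

/-- Clearing denominators in `ℚ(θ)`. -/
theorem exists_natCast_mul_eq_aeval {K : Type*} [Field K] [CharZero K] {θ : K}
    (hθ : IsIntegral ℤ θ) (hgen : IntermediateField.adjoin ℚ {θ} = ⊤) (z : K) :
    ∃ D : ℕ, D ≠ 0 ∧ ∃ T : ℤ[X], (D : K) * z = aeval θ T := by
  have hz : z ∈ Algebra.adjoin ℚ {θ} := by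
    rw [← IntermediateField.adjoin_simple_toSubalgebra_of_isAlgebraic
      (hθ.tower_top (A := ℚ)).isAlgebraic, hgen]
    exact IntermediateField.mem_top
  obtain ⟨P, rfl⟩ := Algebra.adjoin_singleton_eq_range_aeval ℚ θ ▸ hz
  obtain ⟨b, hb, hbP⟩ := IsLocalization.integerNormalization_spec (nonZeroDivisors ℤ) P
  have hb0 : b ≠ 0 := nonZeroDivisors.ne_zero hb
  have h1 : aeval θ (IsLocalization.integerNormalization (nonZeroDivisors ℤ) P) =
      (b : K) * aeval θ P := by
    rw [← aeval_map_algebraMap ℚ, hbP, map_zsmul, zsmul_eq_mul]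
  refine ⟨b.natAbs, Int.natAbs_ne_zero.2 hb0,
    C b.sign * IsLocalization.integerNormalization (nonZeroDivisors ℤ) P, ?_⟩
  rw [map_mul, h1, aeval_C, eq_intCast, ← mul_assoc, ← Int.cast_mul, Int.sign_mul_self,
    Nat.cast_natAbs, Int.abs_eq_natAbs]
  rfl

/-! ### Integers outside `ℤ[θ]` when a condition fails -/

/-- A coordinate argument: if `m z` is an integral combination of `1, θ, …, θ ^ (n - 1)` with
integral `z`, then `m` divides the coefficients. -/
theorem dvd_coeff_of_basis {K : Type*} [Field K] {θ : K} {n : ℕ}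
    (b : Module.Basis (Fin n) ℤ (𝓞 K)) (hb : ∀ i : Fin n, (b i : K) = θ ^ (i : ℕ))
    {z : K} (hz : IsIntegral ℤ z) {m : ℤ} {P : ℤ[X]} (hP : P.natDegree < n)
    (h : (m : K) * z = aeval θ P) (i : ℕ) : m ∣ P.coeff i := by
  obtain ⟨z, rfl⟩ : ∃ w : 𝓞 K, (w : K) = z := ⟨⟨z, hz⟩, rfl⟩
  by_cases hi : i < n
  · have hz' : m • z = ∑ j : Fin n, P.coeff j • b j := by
      apply RingOfIntegers.coe_injective
      rw [aeval_eq_sum_range' hP, ← Fin.sum_univ_eq_sum_range (fun j => P.coeff j • θ ^ j)] at h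
      rw [map_sum, map_zsmul, zsmul_eq_mul]
      simp only [map_zsmul, hb]
      exact h
    have := congrArg (fun x => b.repr x ⟨i, hi⟩) hz'
    rw [Module.Basis.repr_sum_self, map_zsmul, Finsupp.smul_apply, smul_eq_mul] at this
    exact ⟨_, this.symm⟩
  · rw [coeff_eq_zero_of_natDegree_lt (by omega)]
    exact dvd_zero _

/-- The `n`-th power is `(d² b)^(n-1) / d^n = d^(n-2) b^(n-1)`, an integer since `n ≥ 2`. -/
theorem isIntegral_pow_div_of_pow_eq {K : Type*} [Field K] {θ : K} {n : ℕ} (hn : 2 ≤ n) {d b : ℤ}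
    (hd : (d : K) ≠ 0) (h : θ ^ n = ((d * d * b : ℤ) : K)) : IsIntegral ℤ (θ ^ (n - 1) / d) := by
  refine IsIntegral.of_pow (n := n) (by omega) ?_
  obtain ⟨m, rfl⟩ := Nat.exists_eq_add_of_le hn
  have h2 : (θ ^ (2 + m - 1) / d) ^ (2 + m) = algebraMap ℤ K (d ^ m * b ^ (m + 1)) := by
    rw [div_pow, ← pow_mul, mul_comm, pow_mul, h, div_eq_iff (pow_ne_zero _ hd),
      show 2 + m - 1 = m + 1 by omega, eq_intCast]
    push_cast
    ring
  rw [h2]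
  exact isIntegral_algebraMap

theorem IsIntegral.of_sq_eq {R A : Type*} [CommRing R] [CommRing A] [Algebra R A] {r s z : A}
    (hr : IsIntegral R r) (hs : IsIntegral R s) (h : z ^ 2 = r * z + s) : IsIntegral R z := by
  refine isIntegral_trans (A := integralClosure R A) z
    ⟨X ^ 2 - (C ⟨r, hr⟩ * X + C ⟨s, hs⟩), monic_X_pow_sub (by compute_degree!), ?_⟩
  simp [eval₂_sub, eval₂_add, eval₂_mul, h]

/-- Modulo `p`, the quotient `(X ^ p - a ^ p) / (X - a)` is `(X - a) ^ (p - 1)`. -/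
theorem exists_geom_sum_eq (p : ℕ) [Fact p.Prime] (a : ℤ) :
    ∃ r : ℤ[X], ∑ i ∈ Finset.range p, X ^ i * C a ^ (p - 1 - i) =
      (X - C a) ^ (p - 1) + C (p : ℤ) * r := by
  -- With `g := 0`, divisibility mod `p` means vanishing mod `p`.
  obtain ⟨S, W, h⟩ := exists_eq_mul_add_mul_of_map_dvd (p := p) (g := 0)
    (T := ∑ i ∈ Finset.range p, X ^ i * C a ^ (p - 1 - i) - (X - C a) ^ (p - 1)) (by
      rw [Polynomial.map_zero, zero_dvd_iff]
      apply mul_right_cancel₀ (X_sub_C_ne_zero (a : ZMod p))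
      have h := geom_sum₂_mul X (C (a : ZMod p)) p
      rw [← sub_pow_char, ← pow_sub_one_mul (Fact.out : p.Prime).ne_zero] at h
      simp only [Polynomial.map_sub, Polynomial.map_sum, Polynomial.map_mul, Polynomial.map_pow,
        map_X, map_C, Int.coe_castRingHom, zero_mul]
      rw [sub_mul, h, sub_self])
  exact ⟨W, by linear_combination h⟩

/-- Let `s` be the sum and `a^(p-1) - 1 = p² e`. Then `s (y - a) = a - a^p = -p² a e` and `s = (y -
a)^(p-1) + p r`, so `w = s/p` satisfies `w² = r w - a e (y - a)^(p-2)`. -/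
theorem isIntegral_geom_sum_div {K : Type*} [Field K] [CharZero K] {y : K} {p : ℕ} [Fact p.Prime]
    {a : ℤ} (hy : IsIntegral ℤ y) (hya : y ^ p = a) (h : (p : ℤ) ^ 2 ∣ a ^ (p - 1) - 1) :
    IsIntegral ℤ ((∑ i ∈ Finset.range p, y ^ i * (a : K) ^ (p - 1 - i)) / p) := by
  have hp : p.Prime := Fact.out
  have hp0 : (p : K) ≠ 0 := Nat.cast_ne_zero.2 hp.ne_zero
  obtain ⟨e, he⟩ := h
  have hint (P : ℤ[X]) : IsIntegral ℤ (aeval y P) :=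
    adjoin_le_integralClosure hy (aeval_mem_adjoin_singleton _ _)
  obtain ⟨r, hr⟩ := exists_geom_sum_eq p a
  replace hr := congrArg (aeval y) hr
  simp only [map_sum, map_add, map_mul, map_pow, map_sub, aeval_X, map_intCast,
    map_natCast, eq_intCast] at hr
  have hs := geom_sum₂_mul y (a : K) p
  set s := ∑ i ∈ Finset.range p, y ^ i * (a : K) ^ (p - 1 - i)
  have he' : (a : K) ^ p - a = p ^ 2 * (a * e) := by
    have := congrArg (Int.cast : ℤ → K) he
    push_cast at this
    rw [← pow_sub_one_mul hp.ne_zero]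
    linear_combination (a : K) * this
  obtain ⟨k, hk⟩ : ∃ k, p = k + 2 := ⟨p - 2, by have := hp.two_le; omega⟩
  refine IsIntegral.of_sq_eq (hint r) (hint (-(C (a * e) * (X - C a) ^ k))) ?_
  simp only [map_neg, map_mul, map_pow, map_sub, aeval_X, map_intCast, eq_intCast]
  rw [show p - 1 = k + 1 by omega] at hr
  field_simp
  linear_combination s * hr + (y - a) ^ k * (hs + hya - he')

/-! ### The power basis and the equivalence -/

/-- If every integer of `K` is a polynomial in `θ`, the powers of `θ` form an integral basis. -/
theorem exists_basis_of_forall_exists_aeval_eq {K : Type*} [Field K] {θ : K} {f : ℤ[X]} {n : ℕ}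
    (hmonic : f.Monic) (hdeg : f.natDegree = n) (hθ : IsIntegral ℤ θ) (hroot : aeval θ f = 0)
    (hker : ∀ P : ℤ[X], aeval θ P = 0 → f ∣ P)
    (hspan : ∀ z : K, IsIntegral ℤ z → ∃ P : ℤ[X], aeval θ P = z) :
    ∃ b : Module.Basis (Fin n) ℤ (𝓞 K), ∀ i : Fin n, (b i : K) = θ ^ (i : ℕ) := by
  obtain ⟨τ, rfl⟩ : ∃ w : 𝓞 K, (w : K) = θ := ⟨⟨θ, hθ⟩, rfl⟩
  have hli : LinearIndependent ℤ fun i : Fin n => τ ^ (i : ℕ) := by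
    rw [Fintype.linearIndependent_iff]
    intro c hc i
    have h0 : aeval (τ : K) (∑ j : Fin n, C (c j) * X ^ (j : ℕ)) = 0 := by
      have := congrArg (algebraMap (𝓞 K) K) hc
      rw [map_sum, map_zero] at this
      rw [map_sum, ← this]
      refine Finset.sum_congr rfl fun j _ => ?_
      simp
    have hlt : (∑ j : Fin n, C (c j) * X ^ (j : ℕ)).degree < (n : WithBot ℕ) :=
      mem_degreeLT.1 <| Submodule.sum_mem _ fun j _ => mem_degreeLT.2 <|
        (degree_C_mul_X_pow_le _ _).trans_lt (Nat.cast_lt.2 j.2)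
    have hz := eq_zero_of_dvd_of_degree_lt (hker _ h0)
      (by rwa [degree_eq_natDegree hmonic.ne_zero, hdeg])
    have := congrArg (fun P => P.coeff i) hz
    simpa [finsetSum_coeff, coeff_X_pow, Fin.val_inj] using this
  refine ⟨Module.Basis.mk hli ?_, fun i => by rw [Module.Basis.mk_apply]; rfl⟩
  rintro z -
  obtain ⟨P, hP⟩ := hspan z (RingOfIntegers.isIntegral_coe z)
  have hlt : (P %ₘ f).natDegree < n := by
    rw [← hdeg]
    refine natDegree_modByMonic_lt _ hmonic ?_
    rintro rfl
    simp at hroot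
  have hz : z = ∑ i : Fin n, (P %ₘ f).coeff i • τ ^ (i : ℕ) := by
    apply RingOfIntegers.coe_injective
    rw [← RingOfIntegers.coe_eq_algebraMap, ← hP, ← aeval_modByMonic_eq_self_of_root hroot (p := P), aeval_eq_sum_range' hlt,
      ← Fin.sum_univ_eq_sum_range (fun j => (P %ₘ f).coeff j • (τ : K) ^ j), map_sum]
    refine Finset.sum_congr rfl fun j _ => ?_
    rw [map_zsmul, map_pow]
  rw [hz]
  exact Submodule.sum_mem _ fun i _ => Submodule.smul_mem _ _ (Submodule.subset_span ⟨i, rfl⟩)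

theorem corollary1p5 {K : Type*} [Field K] [NumberField K] (n : ℕ) (hn : 2 ≤ n) (a : ℤ)
    (hirr : Irreducible (X ^ n - C a : ℤ[X]))
    (θ : K) (hroot : aeval θ (X ^ n - C a : ℤ[X]) = 0)
    (hgen : IntermediateField.adjoin ℚ {θ} = ⊤) :
    (∃ b : Module.Basis (Fin n) ℤ (𝓞 K), ∀ i : Fin n, (b i : K) = θ ^ (i : ℕ)) ↔
      (Squarefree a ∧ ∀ p : ℕ, p.Prime → p ∣ n → ¬ ((p : ℤ) ^ 2 ∣ a ^ (p - 1) - 1)) := by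
  have hn0 : n ≠ 0 := by omega
  have hmonic : (X ^ n - C a : ℤ[X]).Monic := monic_X_pow_sub_C a hn0
  have hdeg : (X ^ n - C a : ℤ[X]).natDegree = n := natDegree_X_pow_sub_C
  have hθ : IsIntegral ℤ θ := ⟨_, hmonic, hroot⟩
  have hθn : θ ^ n = a := by simpa [sub_eq_zero] using hroot
  have hmin : minpoly ℤ θ = X ^ n - C a :=
    eq_of_monic_of_associated (minpoly.monic hθ) hmonic <|
      ((minpoly.prime_of_isIntegrallyClosed hθ).irreducible).associated_of_dvd hirr
        (minpoly.isIntegrallyClosed_dvd hθ hroot)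
  have hker (P : ℤ[X]) (hP : aeval θ P = 0) : X ^ n - C a ∣ P :=
    hmin ▸ minpoly.isIntegrallyClosed_dvd hθ hP
  constructor
  · rintro ⟨b, hb⟩
    constructor
    · rintro d ⟨c, hc⟩
      have hd : (d : K) ≠ 0 := by
        rintro hd
        have ha : a = 0 := by rw [hc, Int.cast_eq_zero.1 hd, zero_mul, zero_mul]
        have hθ0 : aeval θ (X : ℤ[X]) = 0 := by
          rw [aeval_X]
          exact pow_eq_zero_iff hn0 |>.1 (by rw [hθn, ha, Int.cast_zero])
        have := natDegree_le_of_dvd (hker X hθ0) X_ne_zero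
        rw [hdeg, natDegree_X] at this
        omega
      have hint := isIntegral_pow_div_of_pow_eq hn hd (hc ▸ hθn)
      have := dvd_coeff_of_basis b hb hint (m := d) (P := X ^ (n - 1))
        (by rw [natDegree_X_pow]; omega) (by simp [mul_div_cancel₀, hd]) (n - 1)
      rw [coeff_X_pow_self] at this
      exact isUnit_of_dvd_one this
    · intro p hp ⟨m, hm⟩ hpa
      have : Fact p.Prime := ⟨hp⟩
      subst hm
      have hm0 : 0 < m := Nat.pos_of_ne_zero (right_ne_zero_of_mul hn0)
      -- Here `y = θ^m`, so `y^p = a`. The sum has coefficient `1` in degree `m (p-1) < n`, which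
      -- would force `p ∣ 1`.
      have hint := isIntegral_geom_sum_div (hθ.pow m) (by rw [← pow_mul, mul_comm, hθn]) hpa
      have hlt {i : ℕ} (hi : i < p) : m * i < p * m := by
        rw [mul_comm p]
        exact Nat.mul_lt_mul_of_pos_left hi hm0
      have := dvd_coeff_of_basis b hb hint (m := p)
        (P := ∑ i ∈ Finset.range p, X ^ (m * i) * C a ^ (p - 1 - i)) ?_ ?_ (m * (p - 1))
      · simp only [finsetSum_coeff, ← C_pow, coeff_mul_C, coeff_X_pow] at this
        rw [Finset.sum_eq_single_of_mem (p - 1) (by simp [hp.pos])] at this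
        · simp at this
          exact hp.one_lt.ne' (Nat.dvd_one.1 (by exact_mod_cast this))
        · intro i _ hi
          rw [if_neg fun h => hi (Nat.eq_of_mul_eq_mul_left hm0 h).symm, zero_mul]
      · refine (natDegree_sum_le_of_forall_le (n := m * (p - 1)) _ _ fun i hi => ?_).trans_lt
          (hlt (Nat.sub_lt hp.pos one_pos))
        rw [← C_pow, mul_comm]
        exact (natDegree_C_mul_X_pow_le _ _).trans (Nat.mul_le_mul_left m
          (Nat.le_sub_one_of_lt (Finset.mem_range.1 hi)))
      · have hp0 : (p : K) ≠ 0 := Nat.cast_ne_zero.2 hp.ne_zero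
        simp [mul_div_cancel₀, hp0, pow_mul]
  · rintro ⟨hsq, hw⟩
    have hspan (z : K) (hz : IsIntegral ℤ z) : ∃ P : ℤ[X], aeval θ P = z := by
      obtain ⟨D, hD, T, hT⟩ := exists_natCast_mul_eq_aeval hθ hgen z
      exact exists_aeval_eq_of_forall_prime (fun p hp z hz T hT =>
        exists_aeval_eq_of_prime_mul_of_pow hn0 hθ hker hroot hsq hw hp hz hT) D hD z hz T hT
    exact exists_basis_of_forall_exists_aeval_eq hmonic hdeg hθ hroot hker hspan
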